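/- For two graphs $H_1,H_2$, the Ramsey number $r(H_1,H_2)$ is the smallest integer $N$ such that for every simple graph $G$ on $N$ vertices, either $G$ contains $H_1$ as a subgraph or the complement $\overline{G}$ contains $H_2$ as a subgraph (subgraphs need not be induced). Let $C_4$ be the cycle of length $4$, and let $B_n$ be the book graph consisting of $n$ triangles sharing a common edge. Let $q\ge 4$ be an even prime power. If $t$ is an integer with $0\le t\le q-1$ and $t\ne 1$, then \[ r\bigl(C_4,B_{(q-1)^2+(t-2)}\bigr)=q^2+t . \] -/

import Mathlib

open SimpleGraph

/-- The book graph `B_n`: two adjacent spine vertices (the left summand), and `n` pairwise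
nonadjacent page vertices (the right summand), each adjacent to both spine vertices. This is
`n` triangles sharing the spine edge. -/
def bookGraph (n : ℕ) : SimpleGraph (Fin 2 ⊕ Fin n) where
  Adj x y := x ≠ y ∧ (x.isLeft = true ∨ y.isLeft = true)
  symm := ⟨fun _ _ h => ⟨h.1.symm, h.2.symm⟩⟩
  loopless := ⟨fun _ h => h.1 rfl⟩

/-- The Ramsey number `r(H₁, H₂)`: the least `N` such that every graph `G` on `N` vertices
contains `H₁` as a (not necessarily induced) subgraph, or its complement contains `H₂`.
The infimum over `ℕ` of a nonempty set is its least element; an assertion that this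
number equals a positive integer includes that the set is nonempty, as `sInf ∅ = 0`. -/
noncomputable def ramseyNumber {α β : Type*} (H₁ : SimpleGraph α) (H₂ : SimpleGraph β) : ℕ :=
  sInf {N : ℕ | ∀ G : SimpleGraph (Fin N), H₁.IsContained G ∨ H₂.IsContained Gᶜ}

/-! Let `N = q ^ 2 + t = n + 2 * q + 1`. Without a `C₄`, distinct vertices share at most one
neighbour, and `B_n` appears in the complement once a nonadjacent pair has fewer than `2 * q`
neighbours in all.

Upper bound (`exists_not_adj_degree_add_degree_lt`): summing `d ^ 2 - d + e` over the vertices, with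
`d` the degree and `e` the number of vertices sharing no neighbour with the given one, yields `N *
(N - 1)`. As `q + 1` is odd, each degree above `q` contributes at least `q ^ 2 + q + 1`, more than
the average `N - 1`. If no pair qualifies, the smaller degrees cannot compensate.

Lower bound: `N - 1` vertices of a polarity graph of the plane of order `q` induce minimum degree
`q`. In characteristic two the absolute points are collinear, so their lost degree is restored by
one point at infinity, or their line is deleted. -/

namespace SimpleGraph

/-! ### Both containments in terms of neighbourhoods -/

variable {V : Type*} {G : SimpleGraph V}

/-- A graph without a four-cycle is one in which distinct vertices have at most one common
neighbour. -/
theorem not_cycleGraph_four_isContained_iff :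
    ¬ (cycleGraph 4).IsContained G ↔
      ∀ u v x y, u ≠ v → G.Adj u x → G.Adj v x → G.Adj u y → G.Adj v y → x = y := by
  constructor
  · intro h u v x y huv hux hvx huy hvy
    by_contra hxy
    refine h ⟨⟨⟨![u, x, v, y], ?_⟩, ?_⟩⟩
    · intro i j hij
      rw [cycleGraph_adj] at hij
      fin_cases i <;> fin_cases j <;>
        first
          | exact absurd hij (by decide)
          | simp [hux, hvx, huy, hvy, hux.symm, hvx.symm, huy.symm, hvy.symm]
    · intro i j hij
      fin_cases i <;> fin_cases j <;>
        simp_all [hux.ne, hvx.ne, huy.ne, hvy.ne, hux.ne', hvx.ne', huy.ne', hvy.ne', Ne.symm huv]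
  · rintro h ⟨f⟩
    have adj (i j : Fin 4) (hij : (cycleGraph 4).Adj i j) : G.Adj (f i) (f j) := f.toHom.map_adj hij
    have := h (f 0) (f 2) (f 1) (f 3) (f.injective.ne (by decide))
      (adj _ _ (by rw [cycleGraph_adj]; decide)) (adj _ _ (by rw [cycleGraph_adj]; decide))
      (adj _ _ (by rw [cycleGraph_adj]; decide)) (adj _ _ (by rw [cycleGraph_adj]; decide))
    exact absurd (f.injective this) (by decide)

variable [Fintype V] [DecidableEq V] [DecidableRel G.Adj]

/-- The complement contains a book with `n` pages exactly when some nonadjacent pair misses `n`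
vertices. -/
theorem bookGraph_isContained_compl_iff (n : ℕ) :
    (bookGraph n).IsContained Gᶜ ↔ ∃ u v, u ≠ v ∧ ¬ G.Adj u v ∧
      n + (G.neighborFinset u ∪ G.neighborFinset v).card + 2 ≤ Fintype.card V := by
  have key (u v : V) (huv : u ≠ v) (hadj : ¬ G.Adj u v) :
      ((G.neighborFinset u ∪ G.neighborFinset v) ∪ {u, v})ᶜ.card
        + (G.neighborFinset u ∪ G.neighborFinset v).card + 2 = Fintype.card V := by
    rw [← Finset.card_compl_add_card ((G.neighborFinset u ∪ G.neighborFinset v) ∪ {u, v}),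
      Finset.card_union_of_disjoint (t := {u, v}), Finset.card_pair huv, add_assoc]
    rw [Finset.disjoint_left]
    intro x hx
    have hadj' : ¬ G.Adj v u := fun h => hadj h.symm
    simp only [Finset.mem_union, mem_neighborFinset, Finset.mem_insert,
      Finset.mem_singleton] at hx ⊢
    rintro (rfl | rfl) <;> simp_all
  constructor
  · rintro ⟨f⟩
    have adj (i j) (hij : (bookGraph n).Adj i j) : Gᶜ.Adj (f i) (f j) := f.toHom.map_adj hij
    have h01 := adj (.inl 0) (.inl 1) (by simp [bookGraph])
    rw [compl_adj] at h01
    refine ⟨_, _, h01.1, h01.2, ?_⟩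
    rw [← key _ _ h01.1 h01.2, add_le_add_iff_right, add_le_add_iff_right]
    have : (Finset.univ.image fun i : Fin n => f (.inr i)).card = n :=
      (Finset.card_image_of_injective _ fun i j hij =>
        Sum.inr_injective (f.injective hij)).trans (by simp)
    refine this.symm.trans_le (Finset.card_le_card fun x hx => ?_)
    simp only [Finset.mem_image, Finset.mem_univ, true_and] at hx
    obtain ⟨i, rfl⟩ := hx
    have h0 := adj (.inl 0) (.inr i) (by simp [bookGraph])
    have h1 := adj (.inl 1) (.inr i) (by simp [bookGraph])
    rw [compl_adj] at h0 h1
    simp only [Finset.mem_compl, Finset.mem_union, mem_neighborFinset, Finset.mem_insert,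
      Finset.mem_singleton]
    rintro ((h | h) | h | h)
    exacts [h0.2 h, h1.2 h, h0.1 h.symm, h1.1 h.symm]
  · rintro ⟨u, v, huv, hadj, hn⟩
    rw [← key u v huv hadj, add_le_add_iff_right, add_le_add_iff_right] at hn
    obtain ⟨s, hs, hcard⟩ := Finset.exists_subset_card_eq hn
    let e := s.equivFinOfCardEq hcard
    have he (i : Fin n) : ¬ G.Adj u (e.symm i) ∧ ¬ G.Adj v (e.symm i) ∧
        (e.symm i : V) ≠ u ∧ (e.symm i : V) ≠ v := by
      have := hs (e.symm i).2
      simp at this; tauto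
    refine ⟨⟨⟨Sum.elim ![u, v] fun i => (e.symm i : V), ?_⟩, ?_⟩⟩
    · have hadj' : ¬ G.Adj v u := fun h => hadj h.symm
      rintro (i | i) (j | j) ⟨hne, hl⟩
      · fin_cases i <;> fin_cases j <;> simp_all [Ne.symm huv]
      · obtain ⟨h1, h2, h3, h4⟩ := he j
        fin_cases i <;> simp_all [eq_comm]
      · obtain ⟨h1, h2, h3, h4⟩ := he i
        fin_cases j <;> simp_all [adj_comm, eq_comm]
      · simp at hl
    · rw [RelHom.coeFn_mk]
      refine Function.Injective.sumElim ?_ (Subtype.val_injective.comp e.symm.injective) ?_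
      · intro i j hij
        fin_cases i <;> fin_cases j <;> simp_all [Ne.symm huv]
      · intro i j
        obtain ⟨h1, h2, h3, h4⟩ := he j
        fin_cases i <;> simp_all [eq_comm]

end SimpleGraph

/-! ### Counting walks of length two: the upper bound -/

namespace SimpleGraph

variable {V : Type*} [Fintype V] {G : SimpleGraph V} [DecidableRel G.Adj]

theorem sum_sum_neighborFinset_degree :
    ∑ v, ∑ x ∈ G.neighborFinset v, G.degree x = ∑ x, G.degree x ^ 2 := by
  simp_rw [neighborFinset_eq_filter, Finset.sum_filter]
  rw [Finset.sum_comm]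
  refine Finset.sum_congr rfl fun x _ => ?_
  rw [← Finset.sum_filter, Finset.sum_const, sq, smul_eq_mul]
  congr 1
  rw [← card_neighborFinset_eq_degree, neighborFinset_eq_filter]
  simp_rw [adj_comm]

variable [DecidableEq V]

/-- The vertices other than `v` that share no neighbour with `v`. -/
def noCommonNeighbors (G : SimpleGraph V) [DecidableRel G.Adj] (v : V) : Finset V :=
  {w | w ≠ v ∧ G.neighborFinset v ∩ G.neighborFinset w = ∅}

theorem sum_card_inter_neighborFinset (v : V) :
    ∑ w, (G.neighborFinset v ∩ G.neighborFinset w).card = ∑ x ∈ G.neighborFinset v, G.degree x := by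
  have h (w : V) : (G.neighborFinset v ∩ G.neighborFinset w).card
      = ∑ x ∈ G.neighborFinset v, if G.Adj x w then 1 else 0 := by
    rw [← Finset.filter_mem_eq_inter, Finset.card_filter]
    simp [adj_comm]
  simp_rw [h]
  rw [Finset.sum_comm]
  refine Finset.sum_congr rfl fun x _ => ?_
  rw [← card_neighborFinset_eq_degree, neighborFinset_eq_filter, Finset.card_filter]

/-- Walks of length two from `v` return to `v` exactly `G.degree v` times and reach any other vertex
at most once. -/
theorem sum_degree_sq_add_sum_noCommonNeighbors
    (hG : ∀ u v, u ≠ v → (G.neighborFinset u ∩ G.neighborFinset v).card ≤ 1) :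
    ∑ v, (G.degree v ^ 2 + (G.noCommonNeighbors v).card)
      = Fintype.card V * (Fintype.card V - 1) + ∑ v, G.degree v := by
  have h (v : V) : ∑ x ∈ G.neighborFinset v, G.degree x + (G.noCommonNeighbors v).card
      = (Fintype.card V - 1) + G.degree v := by
    rw [← sum_card_inter_neighborFinset, noCommonNeighbors, Finset.card_filter,
      ← Finset.sum_add_distrib, ← Finset.add_sum_erase _ _ (Finset.mem_univ v), add_comm]
    congr 1
    · rw [Finset.sum_congr rfl (g := fun _ => 1), Finset.sum_const]
      · simp
      · intro w hw
        have hwv := Finset.ne_of_mem_erase hw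
        have := hG v w hwv.symm
        by_cases h0 : G.neighborFinset v ∩ G.neighborFinset w = ∅
        · simp [hwv, h0]
        · have := Finset.card_pos.2 (Finset.nonempty_iff_ne_empty.2 h0)
          simp only [h0, and_false, if_false]
          omega
    · simp
  rw [Finset.sum_add_distrib, ← sum_sum_neighborFinset_degree, ← Finset.sum_add_distrib]
  simp_rw [h]
  simp [Finset.sum_add_distrib]

/-- When common neighbours are unique, a neighbourhood induces a matching, which cannot be
perfect if the degree is odd. -/
theorem exists_adj_mem_noCommonNeighbors_of_odd
    (hG : ∀ u v, u ≠ v → (G.neighborFinset u ∩ G.neighborFinset v).card ≤ 1)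
    {v : V} (hv : Odd (G.degree v)) : ∃ w ∈ G.noCommonNeighbors v, G.Adj v w := by
  by_contra! hcon
  have hex (w : V) (hw : w ∈ G.neighborFinset v) :
      ∃ x, G.Adj v x ∧ G.Adj w x := by
    rw [mem_neighborFinset] at hw
    have h1 : w ∉ G.noCommonNeighbors v := fun h => hcon w h hw
    simp only [noCommonNeighbors, Finset.mem_filter, Finset.mem_univ, true_and, not_and] at h1
    obtain ⟨x, hx⟩ := Finset.nonempty_iff_ne_empty.2 (h1 hw.ne')
    exact ⟨x, by simpa using hx⟩
  choose f hf1 hf2 using hex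
  -- Matching partners form an involution without fixed points, so the degree would be even.
  have h0 : ∑ w ∈ G.neighborFinset v, (1 : ZMod 2) = 0 := by
    refine Finset.sum_involution f (fun _ _ => by decide)
      (fun w hw _ h => G.irrefl (h ▸ hf2 w hw)) (fun w hw => by simpa using hf1 w hw) ?_
    intro w hw
    have hw' : G.Adj v w := by simpa using hw
    have hfw : f w hw ∈ G.neighborFinset v := by simpa using hf1 w hw
    refine Finset.card_le_one.1 (hG v (f w hw) (hf1 w hw).ne) _ ?_ _ ?_
    · simpa using ⟨hf1 _ hfw, hf2 _ hfw⟩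
    · simpa using ⟨hw', (hf2 w hw).symm⟩
  rw [Finset.sum_const, card_neighborFinset_eq_degree, nsmul_one,
    ZMod.natCast_eq_zero_iff_even] at h0
  exact (Nat.not_even_iff_odd.2 hv) h0

/-- A set of vertices in which any two members with a common neighbour are adjacent meets each
neighbourhood in at most two vertices. -/
theorem card_neighborFinset_inter_le_two
    (hG : ∀ u v, u ≠ v → (G.neighborFinset u ∩ G.neighborFinset v).card ≤ 1)
    {D : Finset V} (hD : ∀ u ∈ D, ∀ v ∈ D, u ≠ v → ¬ G.Adj u v → v ∈ G.noCommonNeighbors u)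
    (v : V) : (G.neighborFinset v ∩ D).card ≤ 2 := by
  by_contra! h
  obtain ⟨a, b, c, ha, hb, hc, hab, hac, hbc⟩ := Finset.two_lt_card_iff.1 h
  simp only [Finset.mem_inter, mem_neighborFinset] at ha hb hc
  -- Sharing `v` forces adjacency, so `v` and `a` would share both `b` and `c`.
  have hadj (x y : V) (hx : G.Adj v x ∧ x ∈ D) (hy : G.Adj v y ∧ y ∈ D) (hxy : x ≠ y) :
      G.Adj x y := by
    by_contra hn
    have := hD x hx.2 y hy.2 hxy hn
    simp only [noCommonNeighbors, Finset.mem_filter] at this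
    have hm : v ∈ G.neighborFinset x ∩ G.neighborFinset y := by
      simpa using ⟨hx.1.symm, hy.1.symm⟩
    simp [this.2.2] at hm
  refine hbc (Finset.card_le_one.1 (hG v a ha.1.ne) b ?_ c ?_)
  · simpa using ⟨hb.1, hadj a b ha hb hab⟩
  · simpa using ⟨hc.1, hadj a c ha hc hac⟩

/-- Lower bound on the number of vertices sharing no neighbour with `v`, for `v ∈ D`. -/
theorem card_le_card_noCommonNeighbors
    (hG : ∀ u v, u ≠ v → (G.neighborFinset u ∩ G.neighborFinset v).card ≤ 1)
    {D : Finset V} (hD : ∀ u ∈ D, ∀ v ∈ D, u ≠ v → ¬ G.Adj u v → v ∈ G.noCommonNeighbors u)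
    {v : V} (hv : v ∈ D) : D.card ≤ (G.noCommonNeighbors v).card + 3 := by
  have hsub : D ⊆ (G.noCommonNeighbors v ∪ (G.neighborFinset v ∩ D)) ∪ {v} := by
    intro w hw
    by_cases hwv : w = v
    · simp [hwv]
    · by_cases ha : G.Adj v w
      · simp [ha, hw]
      · simp [hD v hv w hw (Ne.symm hwv) ha]
  have h1 := Finset.card_le_card hsub
  have h2 := Finset.card_union_le (G.noCommonNeighbors v ∪ (G.neighborFinset v ∩ D)) {v}
  have h3 := Finset.card_union_le (G.noCommonNeighbors v) (G.neighborFinset v ∩ D)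
  have h4 := card_neighborFinset_inter_le_two hG hD v
  rw [Finset.card_singleton] at h2
  omega

/-- A graph with unique common neighbours on between `q ^ 2` and `q ^ 2 + q - 1` vertices, `q`
even, has two nonadjacent vertices that together have fewer than `2 * q` neighbours. -/
theorem exists_not_adj_degree_add_degree_lt {q : ℕ} (hq : Even q) (hq4 : 4 ≤ q)
    (hG : ∀ u v, u ≠ v → (G.neighborFinset u ∩ G.neighborFinset v).card ≤ 1)
    (hl : q ^ 2 ≤ Fintype.card V) (hu : Fintype.card V < q ^ 2 + q) :
    ∃ u v, u ≠ v ∧ ¬ G.Adj u v ∧ G.degree u + G.degree v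
      < 2 * q + (G.neighborFinset u ∩ G.neighborFinset v).card := by
  by_contra! hcon
  set D : Finset V := {v | G.degree v ≤ q} with hDdef
  have memD (v : V) : v ∈ D ↔ G.degree v ≤ q := by simp [hDdef]
  -- A degree sum of at most `2 * q` leaves no room for a common neighbour.
  have hD : ∀ u ∈ D, ∀ v ∈ D, u ≠ v → ¬ G.Adj u v → v ∈ G.noCommonNeighbors u := by
    intro u hu v hv huv hadj
    rw [memD] at hu hv
    have := hcon u v huv hadj
    simp only [noCommonNeighbors, Finset.mem_filter, Finset.mem_univ, true_and]
    exact ⟨huv.symm, Finset.card_eq_zero.1 (by omega)⟩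
  have hsum : ∑ v, ((G.degree v : ℤ) ^ 2 - G.degree v + (G.noCommonNeighbors v).card)
      = Fintype.card V * (Fintype.card V - 1) := by
    have := sum_degree_sq_add_sum_noCommonNeighbors hG
    have hpos : 1 ≤ Fintype.card V := by nlinarith
    zify [hpos] at this
    rw [Finset.sum_add_distrib] at this
    rw [Finset.sum_add_distrib, Finset.sum_sub_distrib]
    linarith
  have hbig (v : V) (hv : v ∉ D) :
      (q : ℤ) ^ 2 + q + 1 ≤ (G.degree v : ℤ) ^ 2 - G.degree v + (G.noCommonNeighbors v).card := by
    rw [memD, not_le] at hv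
    -- In the odd degree `q + 1`, an unmatched neighbour supplies the final `1`.
    rcases (show G.degree v = q + 1 ∨ q + 2 ≤ G.degree v by omega) with h | h
    · obtain ⟨w, hw, -⟩ := exists_adj_mem_noCommonNeighbors_of_odd hG (v := v)
        (by rw [h]; exact hq.add_one)
      have := Finset.card_pos.2 ⟨w, hw⟩
      zify at this
      rw [h]
      push_cast
      nlinarith
    · zify at h
      nlinarith [(G.noCommonNeighbors v).card.cast_nonneg (α := ℤ)]
  have hbound (c : ℤ)
      (hc : ∀ v ∈ D, c ≤ (G.degree v : ℤ) ^ 2 - G.degree v + (G.noCommonNeighbors v).card) :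
      (Fintype.card V - D.card) * ((q : ℤ) ^ 2 + q + 1) + D.card * c
        ≤ Fintype.card V * (Fintype.card V - 1) := by
    rw [← hsum, ← Finset.sum_compl_add_sum D]
    have h1 := Finset.card_nsmul_le_sum Dᶜ _ _ fun v hv => hbig v (Finset.mem_compl.1 hv)
    have h2 := Finset.card_nsmul_le_sum D _ _ hc
    rw [Finset.card_compl, nsmul_eq_mul, Nat.cast_sub (Finset.card_le_univ D)] at h1
    rw [nsmul_eq_mul] at h2
    linarith
  have hl' : (q : ℤ) ^ 2 ≤ Fintype.card V := by exact_mod_cast hl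
  have hu' : (Fintype.card V : ℤ) + 1 ≤ (q : ℤ) ^ 2 + q := by exact_mod_cast hu
  have hq4' : (4 : ℤ) ≤ q := by exact_mod_cast hq4
  generalize hN : (Fintype.card V : ℤ) = N at *
  generalize hQ : (q : ℤ) = Q at *
  -- The deficit that `D` must cover; it is concave in `N`, with equality at `N = 3` and `N = Q ^ 2
  -- + Q - 1`.
  have hdef : 3 * (Q ^ 2 + Q - 1) ≤ N * (Q ^ 2 + Q + 2 - N) := by
    nlinarith [mul_nonneg (sub_nonneg.2 hu') (show 0 ≤ N - 3 by nlinarith)]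
  by_cases hmin : ∀ v, q ≤ G.degree v
  · have := hbound (Q ^ 2 - Q + (D.card - 3)) fun v hv => by
      have hd : G.degree v = q := le_antisymm ((memD v).1 hv) (hmin v)
      have := card_le_card_noCommonNeighbors hG hD hv
      zify at this
      rw [hd, hQ]
      linarith
    -- `D` covers at most `D.card * (2 * Q + 4 - D.card) ≤ (Q + 2) ^ 2`, which is too little.
    nlinarith [sq_nonneg ((D.card : ℤ) - (Q + 2))]
  · push Not at hmin
    obtain ⟨u, hu⟩ := hmin
    by_cases hmin1 : ∀ v, q ≤ G.degree v + 1
    -- As `u` has degree below `q`, it is adjacent to the rest of `D`.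
    · have hD3 : D.card ≤ 3 := by
        have hsub : D ⊆ insert u (G.neighborFinset u ∩ D) := by
          intro w hw
          by_cases hwu : w = u
          · simp [hwu]
          · have hw' := (memD w).1 hw
            by_cases ha : G.Adj u w
            · simp [ha, hw]
            · have := hcon u w (Ne.symm hwu) ha
              omega
        have h1 := Finset.card_le_card hsub
        have h2 := Finset.card_insert_le u (G.neighborFinset u ∩ D)
        have h4 := card_neighborFinset_inter_le_two hG hD u
        omega
      -- Degrees are at least `q - 1 ≥ 3`, and `6 = 3 ^ 2 - 3`.
      have := hbound 6 fun v hv => by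
        have h3 : 3 ≤ G.degree v := by have := hmin1 v; omega
        zify at h3
        nlinarith [(G.noCommonNeighbors v).card.cast_nonneg (α := ℤ)]
      have hD3' : (D.card : ℤ) ≤ 3 := by exact_mod_cast hD3
      nlinarith [mul_nonneg (sub_nonneg.2 hD3') (show 0 ≤ Q ^ 2 + Q - 5 by nlinarith)]
    · push Not at hmin1
      obtain ⟨u, hu⟩ := hmin1
      -- A degree of at most `q - 2` forces degree at least `q + 2` on all nonneighbours, which
      -- alone exceed the total.
      have h1 := Finset.card_nsmul_le_sum (insert u (G.neighborFinset u))ᶜ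
        (fun v => (G.degree v : ℤ) ^ 2 - G.degree v + (G.noCommonNeighbors v).card)
        (Q ^ 2 + 3 * Q + 2) fun v hv => by
          simp only [Finset.mem_compl, Finset.mem_insert, mem_neighborFinset, not_or] at hv
          have := hcon u v (Ne.symm hv.1) hv.2
          have hd : q + 2 ≤ G.degree v := by omega
          zify at hd
          nlinarith [(G.noCommonNeighbors v).card.cast_nonneg (α := ℤ)]
      have h2 := Finset.sum_le_univ_sum_of_nonneg (s := (insert u (G.neighborFinset u))ᶜ)
        (f := fun v => (G.degree v : ℤ) ^ 2 - G.degree v + (G.noCommonNeighbors v).card)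
        fun v => add_nonneg (sub_nonneg.2 (by exact_mod_cast Nat.le_self_pow two_ne_zero _))
          (Int.natCast_nonneg _)
      have h3 : (N - Q + 1) ≤ ((insert u (G.neighborFinset u))ᶜ.card : ℤ) := by
        rw [Finset.card_compl, Nat.cast_sub (Finset.card_le_univ _),
          Finset.card_insert_of_notMem (by simp), card_neighborFinset_eq_degree, hN]
        push_cast
        zify at hu
        linarith
      rw [nsmul_eq_mul] at h1
      have h4 := mul_le_mul_of_nonneg_right h3 (show 0 ≤ Q ^ 2 + 3 * Q + 2 by nlinarith)
      nlinarith

end SimpleGraph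

/-! ### Polarity graphs in characteristic two: the lower bound -/

namespace SimpleGraph

/-- The parabola polarity graph on the affine points of a plane over `K` together with the points
at infinity other than the centre of the parabola: affine points `(a, b)` and `(c, d)` are
adjacent when `b + d = a * c`, and the point at infinity `m` is adjacent to all `(m, y)`. -/
def parabolaPolarityGraph (K : Type*) [Field K] : SimpleGraph ((K × K) ⊕ K) where
  Adj
    | .inl p, .inl r => p ≠ r ∧ p.2 + r.2 = p.1 * r.1
    | .inl p, .inr m => p.1 = m
    | .inr m, .inl p => p.1 = m
    | .inr _, .inr _ => False
  symm := ⟨by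
    rintro (p | m) (r | m') h
    · exact ⟨h.1.symm, by rw [add_comm, h.2, mul_comm]⟩
    · exact h
    · exact h
    · exact h⟩
  loopless := ⟨by
    rintro (p | m) h
    · exact h.1 rfl
    · exact h⟩

section parabolaPolarityGraph

variable {K : Type*} [Field K]

@[simp] theorem parabolaPolarityGraph_adj_inl_inl {p r : K × K} :
    (parabolaPolarityGraph K).Adj (.inl p) (.inl r) ↔ p ≠ r ∧ p.2 + r.2 = p.1 * r.1 := Iff.rfl

@[simp] theorem parabolaPolarityGraph_adj_inl_inr {p : K × K} {m : K} :
    (parabolaPolarityGraph K).Adj (.inl p) (.inr m) ↔ p.1 = m := Iff.rfl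

@[simp] theorem parabolaPolarityGraph_adj_inr_inl {p : K × K} {m : K} :
    (parabolaPolarityGraph K).Adj (.inr m) (.inl p) ↔ p.1 = m := Iff.rfl

@[simp] theorem parabolaPolarityGraph_adj_inr_inr {m m' : K} :
    ¬ (parabolaPolarityGraph K).Adj (.inr m) (.inr m') := id

/-- Two lines meet at most once: for affine points, subtracting the equations gives `(a - a') * (c -
c') = 0`. -/
theorem eq_of_adj_parabolaPolarityGraph (u v x y : (K × K) ⊕ K) (huv : u ≠ v)
    (hux : (parabolaPolarityGraph K).Adj u x) (hvx : (parabolaPolarityGraph K).Adj v x)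
    (huy : (parabolaPolarityGraph K).Adj u y) (hvy : (parabolaPolarityGraph K).Adj v y) :
    x = y := by
  have aux (a b a' b' c d c' d' : K) (h : ¬ (a = a' ∧ b = b')) (h1 : b + d = a * c)
      (h2 : b' + d = a' * c) (h3 : b + d' = a * c') (h4 : b' + d' = a' * c') :
      c = c' ∧ d = d' := by
    have hne : a - a' ≠ 0 := by
      intro h0
      obtain rfl := sub_eq_zero.1 h0
      exact h ⟨rfl, by linear_combination h1 - h2⟩
    have hc : c = c' := mul_left_cancel₀ hne (by linear_combination -h1 + h2 + h3 - h4)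
    subst hc
    exact ⟨rfl, by linear_combination h1 - h3⟩
  rcases u with ⟨a, b⟩ | m <;> rcases v with ⟨a', b'⟩ | m' <;> rcases x with ⟨c, d⟩ | n <;>
    rcases y with ⟨c', d'⟩ | n' <;> simp at huv hux hvx huy hvy ⊢
  · exact aux a b a' b' c d c' d' (by tauto) hux.2 hvx.2 huy.2 hvy.2
  · obtain rfl : a = a' := huy.trans hvy.symm
    exact huv rfl (by linear_combination hux.2 - hvx.2)
  · obtain rfl : a = a' := hux.trans hvx.symm
    exact huv rfl (by linear_combination huy.2 - hvy.2)
  · exact hux.symm.trans huy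
  · obtain rfl : c = c' := hvx.trans hvy.symm
    exact ⟨rfl, by linear_combination hux.2 - huy.2⟩
  · obtain rfl : c = c' := hux.trans huy.symm
    exact ⟨rfl, by linear_combination hvx.2 - hvy.2⟩
  · exact (huv (hux.symm.trans hvx)).elim

end parabolaPolarityGraph

/-- Some graph on `N` vertices has no four-cycle and minimum degree at least `q`. -/
def HasC4FreeOfMinDegree (N q : ℕ) : Prop :=
  ∃ (V : Type) (_ : Fintype V) (G : SimpleGraph V), Fintype.card V = N ∧
    ¬ (cycleGraph 4).IsContained G ∧ ∀ v, ∃ f : Fin q → V, f.Injective ∧ ∀ i, G.Adj v (f i)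

/-- Vertex sets in which every vertex of the parabola polarity graph keeps `|K|` neighbours give
graphs without four-cycles and with large minimum degree. -/
theorem hasC4FreeOfMinDegree_card_finset {K : Type} [Field K] [Fintype K]
    (S : Finset ((K × K) ⊕ K))
    (hS : ∀ v ∈ S, ∃ f : K → (K × K) ⊕ K, f.Injective ∧
      ∀ c, f c ∈ S ∧ (parabolaPolarityGraph K).Adj v (f c)) :
    HasC4FreeOfMinDegree S.card (Fintype.card K) := by
  refine ⟨S, inferInstance, (parabolaPolarityGraph K).induce S, by simp, ?_, ?_⟩
  · rw [not_cycleGraph_four_isContained_iff]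
    intro u v x y huv hux hvx huy hvy
    exact Subtype.ext (eq_of_adj_parabolaPolarityGraph (K := K) u v x y (Subtype.coe_ne_coe.2 huv)
      (induce_adj.1 hux) (induce_adj.1 hvx) (induce_adj.1 huy) (induce_adj.1 hvy))
  · rintro ⟨v, hv⟩
    obtain ⟨f, hf, h⟩ := hS v hv
    let e := (Fintype.equivFin K).symm
    exact ⟨fun i => ⟨f (e i), (h _).1⟩, fun i j hij =>
      e.injective (hf (congrArg Subtype.val hij)), fun i => (h _).2⟩

section charTwo

variable {K : Type} [Field K]

theorem injective_prod_mk_mul_sub (a b : K) :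
    Function.Injective fun c : K => (Sum.inl (c, a * c - b) : (K × K) ⊕ K) := by
  intro c c' h
  simp only [Sum.inl.injEq, Prod.mk.injEq] at h
  exact h.1

/-- Lists neighbours of `(a, b)`, with a point at infinity in place of the one at `c = 0`, which is
deleted or is the vertex itself. -/
theorem injective_ite_inr (a b m : K) : Function.Injective fun c : K =>
    (open Classical in if c = 0 then .inr m else .inl (c, a * c - b) : (K × K) ⊕ K) := by
  intro c c' h
  by_cases hc : c = 0 <;> by_cases hc' : c' = 0 <;> simp_all

variable [CharP K 2]

/-- An absolute point satisfies `b + b = a * a`, hence `a = 0`. -/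
theorem adj_parabolaPolarityGraph_of_charTwo {a b c : K} (h : a ≠ 0 ∨ c ≠ 0) :
    (parabolaPolarityGraph K).Adj (.inl (a, b)) (.inl (c, a * c - b)) := by
  rw [parabolaPolarityGraph_adj_inl_inl]
  refine ⟨fun heq => ?_, by simp⟩
  simp only [Prod.mk.injEq] at heq
  obtain ⟨rfl, h2⟩ := heq
  have : a * a = 0 := by
    linear_combination -h2 + b * CharTwo.two_eq_zero (R := K)
  simp_all

variable [Fintype K]

/-- Deleting the line `a = 0` and its point at infinity costs each remaining affine point one of its
`q + 1` neighbours. -/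
theorem hasC4FreeOfMinDegree_sq_sub_one :
    HasC4FreeOfMinDegree (Fintype.card K ^ 2 - 1) (Fintype.card K) := by
  classical
  let A : Finset K := {0}ᶜ
  have hA (a : K) : a ∈ A ↔ a ≠ 0 := by simp [A]
  have hcard : ((A ×ˢ (Finset.univ : Finset K)).disjSum A).card = Fintype.card K ^ 2 - 1 := by
    rw [Finset.card_disjSum, Finset.card_product, Finset.card_compl, Finset.card_univ,
      Finset.card_singleton]
    obtain ⟨k, hk⟩ : ∃ k, Fintype.card K = k + 1 := ⟨_, (Nat.succ_pred Fintype.card_ne_zero).symm⟩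
    rw [hk, Nat.add_sub_cancel]
    exact (Nat.sub_eq_of_eq_add (by ring)).symm
  rw [← hcard]
  refine hasC4FreeOfMinDegree_card_finset _ ?_
  rintro (⟨a, b⟩ | m) hv
  · have ha : a ≠ 0 := by simpa [hA] using hv
    refine ⟨_, injective_ite_inr a b a, fun c => ?_⟩
    by_cases hc : c = 0
    · simp [hc, hA, ha]
    · rw [if_neg hc]
      exact ⟨by simp [hA, hc], adj_parabolaPolarityGraph_of_charTwo (.inl ha)⟩
  · have hm : m ≠ 0 := by simpa [hA] using hv
    exact ⟨fun y => .inl (m, y), fun y y' h => by simpa using h, fun y => by simp [hA, hm]⟩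

/-- The points `(0, b)` have only `q - 1` affine neighbours, so the point at infinity `0` must be
kept; hence `1 ≤ s`. -/
theorem hasC4FreeOfMinDegree_sq_add {s : ℕ} (hs : 1 ≤ s) (hsK : s ≤ Fintype.card K) :
    HasC4FreeOfMinDegree (Fintype.card K ^ 2 + s) (Fintype.card K) := by
  classical
  obtain ⟨M, h0, -, hM⟩ := Finset.exists_subsuperset_card_eq (Finset.subset_univ ({0} : Finset K))
    (by simpa using hs) (by simpa using hsK)
  rw [Finset.singleton_subset_iff] at h0
  have hcard : ((Finset.univ : Finset (K × K)).disjSum M).card = Fintype.card K ^ 2 + s := by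
    rw [Finset.card_disjSum, Finset.card_univ, Fintype.card_prod, hM, sq]
  rw [← hcard]
  refine hasC4FreeOfMinDegree_card_finset _ ?_
  rintro (⟨a, b⟩ | m) -
  · by_cases ha : a = 0
    · subst ha
      refine ⟨_, injective_ite_inr 0 b 0, fun c => ?_⟩
      by_cases hc : c = 0
      · simp [hc, h0]
      · rw [if_neg hc]
        exact ⟨by simp, adj_parabolaPolarityGraph_of_charTwo (.inr hc)⟩
    · exact ⟨_, injective_prod_mk_mul_sub a b, fun c =>
        ⟨by simp, adj_parabolaPolarityGraph_of_charTwo (.inl ha)⟩⟩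
  · exact ⟨fun y => .inl (m, y), fun y y' h => by simpa using h, fun y => by simp⟩

end charTwo

/-! ### Assembling the Ramsey number -/

/-- A graph without four-cycles and of minimum degree at least `q` bounds `r(C₄, Bₙ)` from
below. -/
theorem exists_not_isContained_of_hasC4FreeOfMinDegree {N q n : ℕ} (h : HasC4FreeOfMinDegree N q)
    (hn : N ≤ n + 2 * q) : ∃ G : SimpleGraph (Fin N),
      ¬ (cycleGraph 4).IsContained G ∧ ¬ (bookGraph n).IsContained Gᶜ := by
  classical
  obtain ⟨V, _, G, hV, hG, hdeg⟩ := h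
  have hbook : ¬ (bookGraph n).IsContained Gᶜ := by
    rw [bookGraph_isContained_compl_iff]
    rintro ⟨u, v, huv, -, hle⟩
    have hq (w : V) : q ≤ (G.neighborFinset w).card := by
      obtain ⟨f, hf, hadj⟩ := hdeg w
      have := Finset.card_le_card (s := Finset.univ.image f) (t := G.neighborFinset w) fun x hx => by
        obtain ⟨i, -, rfl⟩ := Finset.mem_image.1 hx
        simpa using hadj i
      rwa [Finset.card_image_of_injective _ hf, Finset.card_univ, Fintype.card_fin] at this
    have hone : (G.neighborFinset u ∩ G.neighborFinset v).card ≤ 1 := by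
      rw [Finset.card_le_one]
      intro x hx y hy
      simp only [Finset.mem_inter, mem_neighborFinset] at hx hy
      exact not_cycleGraph_four_isContained_iff.1 hG u v x y huv hx.1 hx.2 hy.1 hy.2
    have := Finset.card_union_add_card_inter (G.neighborFinset u) (G.neighborFinset v)
    have := hq u
    have := hq v
    omega
  let e := G.overFinIso hV
  refine ⟨G.overFin hV, fun h => hG (h.trans ⟨e.symm.toCopy⟩), fun h => hbook (h.trans ?_)⟩
  exact ⟨⟨⟨e.symm, fun {a b} hab => by
    rw [compl_adj] at hab ⊢
    exact ⟨e.symm.injective.ne hab.1, fun h => hab.2 (e.symm.map_adj_iff.1 h)⟩⟩,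
      e.symm.injective⟩⟩

/-- Avoidance passes to induced subgraphs, so one graph on `M` vertices excludes every `k ≤ M`. -/
theorem ramseyNumber_eq_of_forall_of_exists {α β : Type*} {H₁ : SimpleGraph α}
    {H₂ : SimpleGraph β} {N M : ℕ} (hM : N = M + 1)
    (hN : ∀ G : SimpleGraph (Fin N), H₁.IsContained G ∨ H₂.IsContained Gᶜ)
    (hlow : ∃ G : SimpleGraph (Fin M), ¬ H₁.IsContained G ∧ ¬ H₂.IsContained Gᶜ) :
    ramseyNumber H₁ H₂ = N := by
  refine IsLeast.csInf_eq ⟨hN, fun k hk => ?_⟩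
  by_contra! hlt
  obtain ⟨G, h1, h2⟩ := hlow
  let c := Fin.castLEEmb (show k ≤ M by omega)
  rcases hk (G.comap c) with h | h
  · exact h1 (h.trans ⟨(Embedding.comap c G).toCopy⟩)
  · refine h2 (h.trans ⟨⟨⟨c, fun {a b} hab => ?_⟩, c.injective⟩⟩)
    rw [compl_adj] at hab ⊢
    exact ⟨c.injective.ne hab.1, hab.2⟩

theorem isContained_cycleGraph_four_or_bookGraph {q N n : ℕ} (hq : Even q) (hq4 : 4 ≤ q)
    (hl : q ^ 2 ≤ N) (hu : N < q ^ 2 + q) (hn : n + 2 * q + 1 ≤ N) (G : SimpleGraph (Fin N)) :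
    (cycleGraph 4).IsContained G ∨ (bookGraph n).IsContained Gᶜ := by
  classical
  rw [or_iff_not_imp_left, not_cycleGraph_four_isContained_iff, bookGraph_isContained_compl_iff]
  intro hG
  obtain ⟨u, v, huv, hadj, hlt⟩ := exists_not_adj_degree_add_degree_lt (G := G) hq hq4
    (fun u v huv => Finset.card_le_one.2 fun x hx y hy => by
      simp only [Finset.mem_inter, mem_neighborFinset] at hx hy
      exact hG u v x y huv hx.1 hx.2 hy.1 hy.2) (by simpa using hl) (by simpa using hu)
  refine ⟨u, v, huv, hadj, ?_⟩
  have := Finset.card_union_add_card_inter (G.neighborFinset u) (G.neighborFinset v)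
  rw [card_neighborFinset_eq_degree, card_neighborFinset_eq_degree] at this
  rw [Fintype.card_fin]
  omega

end SimpleGraph

/-- As `q ≥ 4`, no subtraction is truncated: `(q - 1) ^ 2 + t - 2` is `((q - 1) ^ 2 + t) - 2`
with `(q - 1) ^ 2 ≥ 9`. -/
theorem theorem2 (q t : ℕ) (hq : IsPrimePow q) (hq_even : Even q) (hq4 : 4 ≤ q)
    (ht : t ≤ q - 1) (ht1 : t ≠ 1) :
    ramseyNumber (cycleGraph 4) (bookGraph ((q - 1) ^ 2 + t - 2)) = q ^ 2 + t := by
  obtain ⟨m, hm, rfl⟩ : ∃ m, m ≠ 0 ∧ q = 2 ^ m := by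
    obtain ⟨p, m, hp, hm, rfl⟩ := hq
    have hp2 : p = 2 := hp.nat_prime.even_iff.1 (Nat.even_pow.1 hq_even).1
    exact ⟨m, hm.ne', by rw [hp2]⟩
  let _ : Fintype (GaloisField 2 m) := Fintype.ofFinite _
  have hK : Fintype.card (GaloisField 2 m) = 2 ^ m := by
    rw [← Nat.card_eq_fintype_card, GaloisField.card 2 m hm]
  generalize 2 ^ m = q at *
  have hn : (q - 1) ^ 2 + t - 2 + 2 * q + 1 = q ^ 2 + t := by
    obtain ⟨k, rfl⟩ := Nat.exists_eq_add_of_le hq4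
    have : 2 ≤ (4 + k - 1) ^ 2 + t := by
      rw [show 4 + k - 1 = 3 + k by omega]
      nlinarith
    zify [this, show 1 ≤ 4 + k by omega]
    ring
  have hpos : 1 ≤ q ^ 2 := Nat.one_le_pow _ _ (by omega)
  refine ramseyNumber_eq_of_forall_of_exists (M := q ^ 2 + t - 1) (by omega)
    (isContained_cycleGraph_four_or_bookGraph hq_even hq4 (by omega) (by omega) hn.le)
    (exists_not_isContained_of_hasC4FreeOfMinDegree (q := q) ?_ (by omega))
  -- The value `t = 1` would need `s = 0`, which neither construction provides.
  rcases Nat.eq_zero_or_pos t with rfl | ht0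
  · simpa [hK] using hasC4FreeOfMinDegree_sq_sub_one (K := GaloisField 2 m)
  · have := hasC4FreeOfMinDegree_sq_add (K := GaloisField 2 m) (s := t - 1) (by omega) (by omega)
    rwa [hK, ← Nat.add_sub_assoc ht0] at this
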